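/- Let $\sigma$ be the substitution $\sigma(a)=ab$, $\sigma(b)=ac$, $\sigma(c)=a$ on the alphabet $\{a,b,c\}$, and let $\mathbb{T}$ be the Tribonacci sequence, i.e. the fixed point of $\sigma$ that begins with $a$; $\mathbb{T}[1,n]$ denotes its prefix of length $n\ge 0$. Let $T_{-2}=\varepsilon$ be the empty word, $T_{-1}=c$ and $T_m=\sigma^m(a)$ for $m\ge 0$, and let $t_m=|T_m|$ for $m\ge -2$ (so $t_{-2}=0$, $t_{-1}=t_0=1$ and $t_m=t_{m-1}+t_{m-2}+t_{m-3}$ for $m\ge 1$). Let $B(n)$ be the number of distinct cubes in $\mathbb{T}[1,n]$, i.e. the number of nonempty words $\omega$ such that $\omega\omega\omega$ is a factor (contiguous subword) of $\mathbb{T}[1,n]$. **Theorem.** $B(n)=0$ for all $0\le n\le 57$. For every $n\ge 58$ there is a unique integer $m\ge 2$ such that $$t_{m-1}+2t_{m-4}\le n<t_m+2t_{m-3};$$ this $m$ satisfies $m\ge 7$, and $$B(n)=\begin{cases} n-\frac12\left(4t_{m-1}-t_{m-2}-3t_{m-3}+m-6\right), & \text{if } n\le \frac{3t_{m-1}-t_{m-3}-3}{2},\\[4pt]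 \frac12\left(t_{m-5}+t_{m-6}-m+3\right), & \text{otherwise.}\end{cases}$$ -/

import Mathlib

namespace Tribonacci

/-- The three-letter alphabet `{a, b, c}`. -/
inductive Letter where
  | a
  | b
  | c
  deriving DecidableEq

/-- The images of the letters under the substitution: `a ↦ ab`, `b ↦ ac`, `c ↦ a`. -/
def substLetter : Letter → List Letter
  | .a => [.a, .b]
  | .b => [.a, .c]
  | .c => [.a]

/-- The substitution `σ` on finite words (the induced morphism of the free monoid). -/
def subst (w : List Letter) : List Letter := w.flatMap substLetter

/-- The words `T_m`: `T_m = σ^m(a)` for `m ≥ 0`, `T_{-1} = c`, `T_{-2} = ε`.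
Indices below `-2` are not used; they get the empty word. -/
def word : ℤ → List Letter
  | Int.ofNat k => subst^[k] [.a]
  | Int.negSucc 0 => [.c]
  | Int.negSucc (_ + 1) => []

/-- The Tribonacci numbers `t_m = |T_m|`. -/
def t (m : ℤ) : ℕ := (word m).length

/-- The Tribonacci sequence `𝕋` (indexed from `0`): its `i`-th letter is the `i`-th letter of
`σ^i(a)`, a word of length greater than `i` which is a prefix of all later `σ^k(a)`;
see `subst_pref` and `seq_unique` for the fixed-point characterization. -/
def seq (i : ℕ) : Letter := (subst^[i] [.a]).getD i .a

/-- The prefix `𝕋[1,n]` of length `n` of the Tribonacci sequence. -/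
def pref (n : ℕ) : List Letter := (List.range n).map seq

/-- `B n` is the number of distinct cubes in `𝕋[1,n]`, that is, the number of nonempty words `ω`
such that `ωωω` is a factor (contiguous subword) of `𝕋[1,n]`. -/
noncomputable def B (n : ℕ) : ℕ :=
  Set.ncard {ω : List Letter | ω ≠ [] ∧ ω ++ ω ++ ω <:+: pref n}

/-- The set counted by `B n` is finite. -/
theorem finite_cubes (n : ℕ) :
    {ω : List Letter | ω ≠ [] ∧ ω ++ ω ++ ω <:+: pref n}.Finite := by
  refine (List.finite_toSet (pref n).sublists).subset ?_
  rintro ω ⟨-, h⟩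
  have h1 : ω.Sublist (ω ++ ω ++ ω) := List.sublist_append_right _ _
  exact List.mem_sublists.2 (h1.trans h.sublist)

theorem subst_append (u v : List Letter) : subst (u ++ v) = subst u ++ subst v := by
  simp [subst]

theorem subst_prefix {u v : List Letter} (h : u <+: v) : subst u <+: subst v := by
  obtain ⟨w, rfl⟩ := h
  exact ⟨subst w, (subst_append u w).symm⟩

theorem length_le_subst (u : List Letter) : u.length ≤ (subst u).length := by
  induction u with
  | nil => simp
  | cons x u ih =>
    have : subst (x :: u) = substLetter x ++ subst u := by simp [subst]
    rw [this, List.length_append, List.length_cons]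
    cases x <;> simp [substLetter] <;> omega

theorem iterate_head (k : ℕ) : ∃ u, subst^[k] [.a] = Letter.a :: u := by
  induction k with
  | zero => exact ⟨[], rfl⟩
  | succ k ih =>
    obtain ⟨u, hu⟩ := ih
    exact ⟨.b :: subst u, by rw [Function.iterate_succ_apply', hu]; simp [subst, substLetter]⟩

theorem lt_length_iterate (k : ℕ) : k < (subst^[k] [.a]).length := by
  induction k with
  | zero => simp
  | succ k ih =>
    obtain ⟨u, hu⟩ := iterate_head k
    rw [Function.iterate_succ_apply', hu]
    rw [hu] at ih
    have h1 := length_le_subst u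
    have : subst (Letter.a :: u) = .a :: .b :: subst u := by simp [subst, substLetter]
    rw [this]
    simp only [List.length_cons] at *
    omega

theorem iterate_prefix {k l : ℕ} (h : k ≤ l) : subst^[k] [.a] <+: subst^[l] [.a] := by
  have step : ∀ j, subst^[j] [.a] <+: subst^[j + 1] [.a] := by
    intro j
    induction j with
    | zero => exact ⟨[.b], rfl⟩
    | succ j ih =>
      rw [Function.iterate_succ_apply' subst j, Function.iterate_succ_apply' subst (j + 1)]
      exact subst_prefix ih
  induction l, h using Nat.le_induction with
  | base => exact List.prefix_rfl
  | succ l _ ih => exact ih.trans (step l)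

/-- Every `σ^k(a)` is a prefix of `𝕋`. -/
theorem pref_length_iterate (k : ℕ) : pref (subst^[k] [.a]).length = subst^[k] [.a] := by
  apply List.ext_getElem
  · simp [pref]
  · intro i _ h2
    have hi := lt_length_iterate i
    simp only [pref, List.getElem_map, List.getElem_range, seq, List.getD_eq_getElem _ _ hi]
    rcases le_total i k with h | h
    · exact (iterate_prefix h).getElem hi
    · exact ((iterate_prefix h).getElem h2).symm

/-- `𝕋` is a fixed point of `σ`: the image of every prefix of `𝕋` is a prefix of `𝕋`. -/
theorem subst_pref (n : ℕ) : subst (pref n) = pref (subst (pref n)).length := by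
  have mono : ∀ {a b : ℕ}, a ≤ b → pref a <+: pref b := by
    intro a b h
    obtain ⟨d, rfl⟩ := Nat.exists_eq_add_of_le h
    exact ⟨_, by rw [pref, pref, List.range_add, List.map_append]⟩
  have h1 : pref n <+: subst^[n] [.a] := by
    rw [← pref_length_iterate n]; exact mono (lt_length_iterate n).le
  have h2 : subst (pref n) <+: pref (subst^[n + 1] [.a]).length := by
    rw [pref_length_iterate, Function.iterate_succ_apply']
    exact subst_prefix h1
  have h3 : pref (subst (pref n)).length <+: pref (subst^[n + 1] [.a]).length :=
    mono (by simpa [pref] using h2.length_le)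
  exact (List.prefix_of_prefix_length_le h2 h3 (by simp [pref])).eq_of_length (by simp [pref])

/-- `𝕋` is the only fixed point of `σ` that begins with `a`. -/
theorem seq_unique (s : ℕ → Letter) (h0 : s 0 = .a)
    (hs : ∀ n, subst ((List.range n).map s) =
      (List.range (subst ((List.range n).map s)).length).map s) : s = seq := by
  have key : ∀ k, (List.range (subst^[k] [.a]).length).map s = subst^[k] [.a] := by
    intro k
    induction k with
    | zero => simp [h0]
    | succ k ih =>
      have := hs (subst^[k] [.a]).length
      rw [ih] at this
      rw [Function.iterate_succ_apply']
      exact this.symm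
  funext i
  have hi := lt_length_iterate i
  rw [seq, List.getD_eq_getElem _ _ hi]
  have h := List.getElem_of_eq (key i).symm hi
  rw [h]
  simp

end Tribonacci

namespace Tribonacci

/-! Every cube of `𝕋` comes from an occurrence of `aa` by iterating `σ`. Since each block `σ(x)`
starts with its only `a`, block boundaries can be read off from the letters, so a repetition extends
to whole blocks and desubstitutes to one of smaller period (`ShiftEq.preimage`). Repetitions of
length at least `3p - 1` keep this property under descent and end at period 1, that is, at `aa`
(`ShiftEq.exists_run`). Conversely, the `k`-th image of `aa` generates a run of period `trib k`; the
runs of periods 1, 2, 4 are one letter too short for a cube, and the one of period `trib (k + 3)`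
has length `3 * trib (k + 3) + excess k`.

Period `trib (k + 3)` thus gives `excess k + 1` cube roots. They are distinct, because a coincidence
would force a fourth power (`cubeRoot_inj`). All of them appear first in the run of the first `aa`,
at index 6, where their cubes end at the consecutive positions `cubeEnd k + d` (`cube_iff`). The
position ranges of different `k` are disjoint and increasing, so `B` alternates between growth with
slope 1 and plateaus; summing gives the two formulas. -/

/-! ### Block structure of the fixed point. -/

/-- The length of `σ^k(a)`, indexed by natural numbers. -/
def trib (k : ℕ) : ℕ := (subst^[k] [.a]).length

/-- The position in `𝕋` at which the image of the letter of index `n` begins. -/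
def pos (n : ℕ) : ℕ := (subst (pref n)).length

/-- The letter of `𝕋` following the first letter of the image of a given letter. -/
def next : Letter → Letter
  | .a => .b
  | .b => .c
  | .c => .a

theorem next_injective : Function.Injective next := by
  intro x y h
  cases x <;> cases y <;> simp_all [next]

theorem next_ne_of_ne {x : Letter} (h : x ≠ .c) : next x ≠ .a := by
  cases x <;> simp_all [next]

theorem pref_length (n : ℕ) : (pref n).length = n := by simp [pref]

theorem pref_succ (n : ℕ) : pref (n + 1) = pref n ++ [seq n] := by
  simp [pref, List.range_succ]

theorem pref_pos (n : ℕ) : pref (pos n) = subst (pref n) := (subst_pref n).symm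

theorem pos_zero : pos 0 = 0 := rfl

theorem pos_succ (n : ℕ) : pos (n + 1) = pos n + (substLetter (seq n)).length := by
  simp [pos, pref_succ, subst]

theorem pos_lt_succ (n : ℕ) : pos n < pos (n + 1) := by
  rw [pos_succ]
  cases seq n <;> simp [substLetter]

theorem pos_strictMono : StrictMono pos := strictMono_nat_of_lt_succ pos_lt_succ

theorem seq_pos_add (n r : ℕ) (hr : r < (substLetter (seq n)).length) :
    seq (pos n + r) = (substLetter (seq n))[r] := by
  have h : pref (pos (n + 1)) = subst (pref n) ++ substLetter (seq n) := by
    rw [pref_pos, pref_succ, subst_append]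
    simp [subst]
  have h1 : pos n + r < (pref (pos (n + 1))).length := by
    rw [pref_length, pos_succ]; omega
  have h2 := List.getElem_of_eq h h1
  rw [List.getElem_append_right (by simp [pos])] at h2
  simp only [pos, Nat.add_sub_cancel_left] at h2
  rw [← h2]
  simp [pref, pos]

theorem seq_pos (n : ℕ) : seq (pos n) = .a := by
  have h := seq_pos_add n 0
  rw [Nat.add_zero] at h
  rw [h (by cases seq n <;> simp [substLetter])]
  cases seq n <;> rfl

theorem seq_pos_succ (n : ℕ) : seq (pos n + 1) = next (seq n) := by
  have h := seq_pos_add n 1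
  have hs := pos_succ n
  have h0 := seq_pos (n + 1)
  cases hn : seq n <;> rw [hn] at h hs <;> simp [substLetter, next] at h hs ⊢
  · exact h
  · exact h
  · rw [← hs, h0]

theorem pos_succ_of_ne {n : ℕ} (h : seq n ≠ .c) : pos (n + 1) = pos n + 2 := by
  rw [pos_succ]
  cases hn : seq n <;> simp_all [substLetter]

theorem pos_succ_of_eq {n : ℕ} (h : seq n = .c) : pos (n + 1) = pos n + 1 := by
  rw [pos_succ, h]; rfl

theorem exists_pos (y : ℕ) : ∃ x, y = pos x ∨ (y = pos x + 1 ∧ seq x ≠ .c) := by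
  induction y with
  | zero => exact ⟨0, Or.inl rfl⟩
  | succ y ih =>
    obtain ⟨x, rfl | ⟨rfl, hx⟩⟩ := ih
    · by_cases hx : seq x = .c
      · exact ⟨x + 1, Or.inl (pos_succ_of_eq hx).symm⟩
      · exact ⟨x, Or.inr ⟨rfl, hx⟩⟩
    · exact ⟨x + 1, Or.inl (pos_succ_of_ne hx).symm⟩

theorem exists_pos_of_seq_eq {y : ℕ} (h : seq y = .a) : ∃ x, y = pos x := by
  obtain ⟨x, rfl | ⟨rfl, hx⟩⟩ := exists_pos y
  · exact ⟨x, rfl⟩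
  · rw [seq_pos_succ] at h
    cases hn : seq x <;> simp_all [next]

theorem exists_pos_of_seq_ne {y : ℕ} (h : seq y ≠ .a) : ∃ x, y = pos x + 1 := by
  obtain ⟨x, rfl | ⟨rfl, hx⟩⟩ := exists_pos y
  · exact absurd (seq_pos x) h
  · exact ⟨x, rfl⟩

theorem seq_eq_of_succ_ne {n : ℕ} (h : seq (n + 1) ≠ .a) : seq n = .a := by
  obtain ⟨x, hx⟩ := exists_pos_of_seq_ne h
  rw [Nat.add_right_cancel hx, seq_pos]

theorem seq_add_two_ne {n : ℕ} (h : seq n = .a) (h' : seq (n + 1) = .a) : seq (n + 2) ≠ .a := by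
  obtain ⟨x, rfl⟩ := exists_pos_of_seq_eq h
  rw [seq_pos_succ] at h'
  have hx : seq x = .c := by cases hn : seq x <;> simp_all [next]
  have h2 : seq (x + 1) ≠ .c := by
    intro h3
    have := seq_eq_of_succ_ne (n := x) (by simp [h3])
    simp [hx] at this
  rw [show pos x + 2 = pos (x + 1) + 1 by rw [pos_succ_of_eq hx], seq_pos_succ]
  cases hn : seq (x + 1) <;> simp_all [next]

/-! ### Repetitions under substitution and desubstitution. -/

/-- `𝕋` agrees with its shift by `p` on the interval `[i, j)`. -/
def ShiftEq (p i j : ℕ) : Prop := ∀ x, i ≤ x → x < j → seq x = seq (x + p)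

theorem ShiftEq.mono {p i j i' j' : ℕ} (h : ShiftEq p i j) (hi : i ≤ i') (hj : j' ≤ j) :
    ShiftEq p i' j' := fun x h1 h2 => h x (by omega) (by omega)

theorem ShiftEq.pos_add {q i j P : ℕ} (h : ShiftEq q i j) (hP : pos (i + q) = pos i + P)
    {x : ℕ} (hi : i ≤ x) (hj : x ≤ j) : pos (x + q) = pos x + P := by
  induction x, hi using Nat.le_induction with
  | base => exact hP
  | succ x hx ih =>
    have h1 := h x hx (by omega)
    rw [show x + 1 + q = x + q + 1 by omega, pos_succ, pos_succ, ← h1, ih (by omega)]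
    omega

/-- The additional letter at `pos j` comes for free: every block begins with `a`, whatever letter it
encodes. -/
theorem ShiftEq.image {q i j P : ℕ} (h : ShiftEq q i j) (hP : pos (i + q) = pos i + P) :
    ShiftEq P (pos i) (pos j + 1) := by
  intro y hy hy'
  obtain ⟨x, rfl | ⟨rfl, hx⟩⟩ := exists_pos y
  · have h1 : i ≤ x := pos_strictMono.le_iff_le.1 hy
    have h2 : x ≤ j := pos_strictMono.le_iff_le.1 (by omega)
    rw [← h.pos_add hP h1 h2, seq_pos, seq_pos]
  · have h2 : x < j := pos_strictMono.lt_iff_lt.1 (by omega)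
    have h1 : i ≤ x := by
      by_contra hc
      have := pos_strictMono.monotone (show x + 1 ≤ i by omega)
      have := pos_succ_of_ne hx
      omega
    rw [show pos x + 1 + P = pos (x + q) + 1 by rw [h.pos_add hP h1 h2.le]; omega,
      seq_pos_succ, seq_pos_succ, h x h1 h2]

/-- An `a` marks a block start, so the shift carries block starts to block starts; the letter after
a block start determines the encoded letter because `next` is injective. -/
theorem ShiftEq.preimage_aux {p i' j' : ℕ} (hij : i' ≤ j')
    (h : ShiftEq p (pos i') (pos j' + 1)) :
    ∃ q, pos (i' + q) = pos i' + p ∧ ShiftEq q i' j' := by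
  have h0 := h (pos i') le_rfl (by have := pos_strictMono.monotone hij; omega)
  rw [seq_pos] at h0
  obtain ⟨z, hz⟩ := exists_pos_of_seq_eq h0.symm
  have hz' : i' ≤ z := pos_strictMono.le_iff_le.1 (by omega)
  obtain ⟨q, rfl⟩ := Nat.exists_eq_add_of_le hz'
  refine ⟨q, hz.symm, ?_⟩
  have key : ∀ j, i' ≤ j → j ≤ j' → ShiftEq q i' j := by
    intro j hj
    induction j, hj using Nat.le_induction with
    | base => intro _ x h1 h2; omega
    | succ j hj ih =>
      intro hjj x h1 h2
      have ih := ih (by omega)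
      rcases Nat.lt_succ_iff_lt_or_eq.1 h2 with h3 | rfl
      · exact ih x h1 h3
      · have h4 := ih.pos_add hz.symm hj le_rfl
        have h5 := pos_strictMono (show x < j' by omega)
        have h6 := h (pos x + 1) (by have := pos_strictMono.monotone hj; omega) (by omega)
        rw [show pos x + 1 + p = pos (x + q) + 1 by omega, seq_pos_succ, seq_pos_succ] at h6
        exact next_injective h6
  exact key j' hij le_rfl

theorem ShiftEq.preimage {p i j : ℕ} (hij : i + 2 ≤ j) (h : ShiftEq p i j) :
    ∃ i' j' q, i' ≤ j' ∧ pos i' ≤ i ∧ j ≤ pos j' + 1 ∧ pos (i' + q) = pos i' + p ∧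
      ShiftEq q i' j' := by
  obtain ⟨i', hi'⟩ := exists_pos i
  obtain ⟨j', hj'⟩ := exists_pos (j - 1)
  have hi1 : pos i' ≤ i := by omega
  -- If `i` is the second letter of a block, it is `b` or `c`, and both it and its shifted copy are
  -- preceded by `a`.
  have hleft : ShiftEq p (pos i') j := by
    intro x hx hxj
    rcases hi' with hi' | ⟨hi', hc⟩
    · exact h x (by omega) hxj
    · rcases Nat.lt_or_ge x i with hlt | hge
      · obtain rfl : x = pos i' := by omega
        have h1 := h i le_rfl (by omega)
        rw [hi', seq_pos_succ] at h1
        rw [show pos i' + 1 + p = pos i' + p + 1 by omega] at h1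
        rw [seq_pos, seq_eq_of_succ_ne]
        rw [← h1]
        exact next_ne_of_ne hc
      · exact h x hge hxj
  -- The right end is already just past a block start, or the last letter is `b` or `c`, so the next
  -- letter on both sides is `a`.
  obtain ⟨j'', hj1, hj2⟩ :
      ∃ j'', j ≤ pos j'' + 1 ∧ (pos j'' + 1 = j ∨ (pos j'' = j ∧ seq (j - 1) ≠ .a)) := by
    rcases hj' with hj' | ⟨hj', hc⟩
    · exact ⟨j', by omega, by omega⟩
    · have := pos_succ_of_ne hc
      refine ⟨j' + 1, by omega, Or.inr ⟨by omega, ?_⟩⟩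
      rw [hj', seq_pos_succ]
      exact next_ne_of_ne hc
  have hij' : i' ≤ j'' := by
    by_contra hc
    have := pos_strictMono (show j'' < i' by omega)
    omega
  have hfull : ShiftEq p (pos i') (pos j'' + 1) := by
    rcases hj2 with hj2 | ⟨hj2, hja⟩
    · exact hleft.mono le_rfl hj2.le
    · intro x hx hxj
      rcases Nat.lt_or_ge x j with hlt | hge
      · exact hleft x hx hlt
      · obtain rfl : x = pos j'' := by omega
        rw [seq_pos, show pos j'' + p = j - 1 + p + 1 by omega]
        rw [h (j - 1) (by omega) (by omega)] at hja
        by_contra hc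
        exact hja (seq_eq_of_succ_ne (Ne.symm hc))
  obtain ⟨q, h1, h2⟩ := hfull.preimage_aux hij'
  exact ⟨i', j'', q, hij', hi1, hj1, h1, h2⟩

/-! ### Tribonacci numbers and iterated block positions. -/

theorem subst_iterate_append (k : ℕ) (u v : List Letter) :
    subst^[k] (u ++ v) = subst^[k] u ++ subst^[k] v := by
  induction k generalizing u v with
  | zero => rfl
  | succ k ih => rw [Function.iterate_succ_apply, subst_append, ih]; rfl

theorem trib_zero : trib 0 = 1 := rfl
theorem trib_one : trib 1 = 2 := rfl
theorem trib_two : trib 2 = 4 := rfl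

theorem trib_add_three (k : ℕ) : trib (k + 3) = trib (k + 2) + trib (k + 1) + trib k := by
  have hc : subst^[k + 1] [.c] = subst^[k] [.a] := rfl
  have hb (k : ℕ) : subst^[k + 1] [.b] = subst^[k] [.a] ++ subst^[k] [.c] :=
    subst_iterate_append k [.a] [.c]
  have ha (k : ℕ) : subst^[k + 1] [.a] = subst^[k] [.a] ++ subst^[k] [.b] :=
    subst_iterate_append k [.a] [.b]
  simp only [trib]
  rw [ha (k + 2), hb (k + 1), hc]
  simp [add_assoc]

theorem trib_growth (k : ℕ) :
    0 < trib k ∧ trib k < trib (k + 1) ∧ trib k + trib (k + 1) < trib (k + 2) := by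
  induction k with
  | zero => simp [trib_zero, trib_one, trib_two]
  | succ k ih =>
    have := trib_add_three k
    simp only [add_assoc, Nat.reduceAdd]
    omega

theorem trib_strictMono : StrictMono trib := strictMono_nat_of_lt_succ fun k => (trib_growth k).2.1

theorem pos_iterate_strictMono (k : ℕ) : StrictMono pos^[k] := pos_strictMono.iterate k

theorem pref_pos_iterate (k n : ℕ) : pref (pos^[k] n) = subst^[k] (pref n) := by
  induction k with
  | zero => rfl
  | succ k ih => rw [Function.iterate_succ_apply', Function.iterate_succ_apply', pref_pos, ih]

theorem pos_iterate_succ {n : ℕ} (h : seq n = .a) (k : ℕ) :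
    pos^[k] (n + 1) = pos^[k] n + trib k := by
  have h1 := congrArg List.length (pref_pos_iterate k (n + 1))
  rw [pref_succ, subst_iterate_append, List.length_append, pref_length, h, ← pref_pos_iterate,
    pref_length] at h1
  exact h1

theorem pos_iterate_zero (k : ℕ) : pos^[k] 0 = 0 := Function.iterate_fixed pos_zero k

theorem seq_zero : seq 0 = .a := rfl

theorem pos_iterate_one (k : ℕ) : pos^[k] 1 = trib k := by
  rw [pos_iterate_succ seq_zero, pos_iterate_zero, zero_add]

theorem ShiftEq.iterate {q i j : ℕ} (h : ShiftEq q i j) (k : ℕ) :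
    ∃ P, pos^[k] (i + q) = pos^[k] i + P ∧ ShiftEq P (pos^[k] i) (pos^[k] j) := by
  induction k with
  | zero => exact ⟨q, rfl, h⟩
  | succ k ih =>
    obtain ⟨P, h1, h2⟩ := ih
    obtain ⟨Q, hQ⟩ := Nat.exists_eq_add_of_le
      (pos_strictMono.monotone (Nat.le_add_right (pos^[k] i) P))
    simp only [Function.iterate_succ_apply']
    exact ⟨Q, by rw [h1, hQ], (h2.image hQ).mono le_rfl (Nat.le_succ _)⟩

/-! ### Runs generated by occurrences of `aa`. -/

/-- The right end of the run of period `trib k` generated by an occurrence of `aa` at `i`. -/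
def runEnd (i : ℕ) : ℕ → ℕ
  | 0 => i + 1
  | k + 1 => pos (runEnd i k) + 1

/-- The run of period `trib (k + 3)` has length `3 * trib (k + 3) + excess k`. -/
def excess : ℕ → ℕ
  | 0 => 0
  | k + 1 => pos (excess k) + 1

theorem pos_iterate_excess (k j : ℕ) :
    pos^[j] (excess k) = ∑ i ∈ Finset.range k, trib (j + i) := by
  induction k generalizing j with
  | zero => simp [excess, pos_iterate_zero]
  | succ k ih =>
    rw [excess, pos_iterate_succ (seq_pos _), ← Function.iterate_succ_apply, ih,
      Finset.sum_range_succ', add_zero]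
    congr 1
    refine Finset.sum_congr rfl fun i _ => ?_
    congr 1
    omega

theorem excess_succ (k : ℕ) : excess (k + 1) = excess k + trib k := by
  have h (k : ℕ) := pos_iterate_excess k 0
  simp only [Function.iterate_zero, id, zero_add] at h
  rw [h, h, Finset.sum_range_succ]

theorem three_mul_excess_le (k : ℕ) : 3 * excess k ≤ trib (k + 3) := by
  induction k with
  | zero => simp [excess]
  | succ k ih =>
    have h1 := trib_add_three (k + 1)
    have h2 := trib_growth k
    rw [excess_succ]
    simp only [add_assoc, Nat.reduceAdd] at *
    omega

theorem two_mul_excess (k : ℕ) : 2 * excess k + 3 + 3 * trib (k + 3) = trib (k + 5) := by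
  induction k with
  | zero => rfl
  | succ k ih =>
    have h0 := trib_add_three k
    have h1 := trib_add_three (k + 1)
    have h2 := trib_add_three (k + 2)
    have h3 := trib_add_three (k + 3)
    rw [excess_succ]
    simp only [add_assoc, Nat.reduceAdd] at *
    omega

theorem runEnd_succ (i k : ℕ) : runEnd i (k + 1) = pos (runEnd i k) + 1 := rfl

theorem pos_iterate_add_two {i : ℕ} (h0 : seq i = .a) (h1 : seq (i + 1) = .a) (k : ℕ) :
    pos^[k] (i + 2) = pos^[k] i + 2 * trib k := by
  rw [pos_iterate_succ h1, pos_iterate_succ h0]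
  omega

theorem shiftEq_runEnd {i : ℕ} (h0 : seq i = .a) (h1 : seq (i + 1) = .a) (k : ℕ) :
    ShiftEq (trib k) (pos^[k] i) (runEnd i k) := by
  induction k with
  | zero =>
    intro x hx hx'
    obtain rfl : x = i := by simp [runEnd] at hx hx'; omega
    rw [trib_zero, h0, h1]
  | succ k ih =>
    rw [Function.iterate_succ_apply', runEnd]
    refine ih.image ?_
    rw [← pos_iterate_succ h0, ← Function.iterate_succ_apply' pos,
      ← Function.iterate_succ_apply' pos, pos_iterate_succ h0]

theorem runEnd_small {i : ℕ} (h1 : seq (i + 1) = .a) :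
    runEnd i 0 + 1 = i + 2 ∧ runEnd i 1 + 1 = pos^[1] (i + 2) ∧
      runEnd i 2 + 1 = pos^[2] (i + 2) ∧ runEnd i 3 = pos^[3] (i + 2) := by
  have e1 : runEnd i 1 + 1 = pos (i + 2) := by
    rw [pos_succ_of_ne (n := i + 1) (by simp [h1]), runEnd_succ, runEnd]
  have s1 : seq (runEnd i 1) = .b := by
    rw [runEnd_succ, runEnd, seq_pos_succ, h1]
    rfl
  have e2 : runEnd i 2 + 1 = pos (pos (i + 2)) := by
    rw [← e1, pos_succ_of_ne (by simp [s1]), runEnd_succ]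
  have s2 : seq (runEnd i 2) = .c := by
    rw [runEnd_succ, seq_pos_succ, s1]
    rfl
  have e3 : runEnd i 3 = pos (pos (pos (i + 2))) := by
    rw [← e2, pos_succ_of_eq s2, runEnd_succ]
  simp only [Function.iterate_succ_apply', Function.iterate_zero, id]
  exact ⟨rfl, e1, e2, e3⟩

/-- The overhang beyond the image of `aa` is a prefix of `𝕋` of length `excess k`. Carrying this
along in the induction makes `pos` additive at the run's end. -/
theorem runEnd_add_three {i : ℕ} (h1 : seq (i + 1) = .a) (k : ℕ) :
    runEnd i (k + 3) = pos^[k + 3] (i + 2) + excess k := by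
  suffices h : runEnd i (k + 3) = pos^[k + 3] (i + 2) + excess k ∧
      ShiftEq (pos^[k + 3] (i + 2)) 0 (excess k) from h.1
  induction k with
  | zero => exact ⟨by simpa [excess] using (runEnd_small h1).2.2.2, fun x _ hx => absurd hx (Nat.not_lt_zero x)⟩
  | succ k ih =>
    obtain ⟨ih1, ih2⟩ := ih
    rw [show k + 1 + 3 = k + 3 + 1 by omega, Function.iterate_succ_apply', runEnd, excess, ih1]
    have h2 : pos (0 + pos^[k + 3] (i + 2)) = pos 0 + pos (pos^[k + 3] (i + 2)) := by
      rw [pos_zero, zero_add, zero_add]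
    refine ⟨?_, ih2.image h2⟩
    rw [add_comm (pos^[k + 3] (i + 2)), ih2.pos_add h2 (Nat.zero_le _) le_rfl]
    omega

theorem pos_add_le (n r : ℕ) : pos n + r ≤ pos (n + r) := by
  induction r with
  | zero => simp
  | succ r ih =>
    have := pos_lt_succ (n + r)
    rw [← add_assoc, ← add_assoc]
    omega

theorem pos_add_two (n : ℕ) : pos n + 3 ≤ pos (n + 2) := by
  have h1 := pos_lt_succ n
  have h2 := pos_lt_succ (n + 1)
  rw [show n + 2 = n + 1 + 1 by omega]
  by_cases h : seq n = .c
  · have h3 : seq (n + 1) ≠ .c := by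
      intro h3
      have := seq_eq_of_succ_ne (n := n) (by simp [h3])
      simp [h] at this
    rw [pos_succ_of_ne h3]
    omega
  · have := pos_succ_of_ne h
    omega

/-- The slack `j + 1` is essential: a cube of period 7 desubstitutes to a repetition of period 4
that is one letter short of a cube, so the bound for cubes alone does not descend. -/
theorem ShiftEq.exists_run (p : ℕ) : ∀ {i j : ℕ}, 1 ≤ p → ShiftEq p i j → i + 2 * p ≤ j + 1 →
    ∃ k s, seq s = .a ∧ seq (s + 1) = .a ∧ p = trib k ∧ pos^[k] s ≤ i ∧ j ≤ runEnd s k := by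
  induction p using Nat.strong_induction_on with
  | _ p ih =>
  intro i j hp h hij
  rcases hp.eq_or_lt with rfl | hp
  · have h2 := h i le_rfl (by omega)
    have h3 : seq i = .a := by
      by_contra hc
      exact hc (seq_eq_of_succ_ne (h2 ▸ hc))
    have h4 : seq (i + 1) = .a := h2 ▸ h3
    refine ⟨0, i, h3, h4, rfl, le_rfl, ?_⟩
    by_contra hc
    simp only [runEnd, not_le] at hc
    have := h (i + 1) (by omega) hc
    exact seq_add_two_ne h3 h4 (this ▸ h4)
  · obtain ⟨i', j', q, hij', hi, hj, hq, hs⟩ := h.preimage (by omega)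
    -- Two consecutive blocks have total length at least 3, so the period strictly drops.
    have hqp : q < p := by
      rcases Nat.lt_or_ge q 2 with hq2 | hq2
      · omega
      · have h1 := pos_add_le (i' + 2) (q - 2)
        have h2 := pos_add_two i'
        rw [show i' + 2 + (q - 2) = i' + q by omega] at h1
        omega
    have hq1 : 1 ≤ q := by
      rcases Nat.eq_zero_or_pos q with rfl | h0
      · rw [add_zero] at hq
        omega
      · exact h0
    have h1 : i' + q ≤ j' := by
      apply pos_strictMono.le_iff_le.1
      omega
    have h2 := hs.pos_add hq (Nat.le_add_right i' q) h1
    have h3 : i' + 2 * q ≤ j' + 1 := by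
      by_contra hc
      have h4 := pos_strictMono.monotone (show j' + 2 ≤ i' + q + q by omega)
      have h5 := pos_add_two j'
      omega
    obtain ⟨k, s, hs0, hs1, rfl, hk1, hk2⟩ := ih q hqp hq1 hs h3
    refine ⟨k + 1, s, hs0, hs1, ?_, ?_, ?_⟩
    · have h6 : pos (pos^[k] s + trib k) = pos (pos^[k] s) + trib (k + 1) := by
        rw [← pos_iterate_succ hs0, ← Function.iterate_succ_apply' pos,
          ← Function.iterate_succ_apply' pos, pos_iterate_succ hs0]
      have h7 := (shiftEq_runEnd hs0 hs1 k).pos_add h6 hk1 (hij'.trans hk2)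
      omega
    · rw [Function.iterate_succ_apply']
      exact (pos_strictMono.monotone hk1).trans hi
    · rw [runEnd]
      have := pos_strictMono.monotone hk2
      omega

theorem ShiftEq.exists_cube_run {p i j : ℕ} (hp : 1 ≤ p) (h : ShiftEq p i j)
    (hij : i + 2 * p ≤ j) :
    ∃ k s, seq s = .a ∧ seq (s + 1) = .a ∧ p = trib (k + 3) ∧ pos^[k + 3] s ≤ i ∧
      j ≤ pos^[k + 3] s + 2 * p + excess k := by
  obtain ⟨k, s, h0, h1, rfl, hi, hj⟩ := h.exists_run p hp (by omega)
  have hpos := pos_iterate_add_two h0 h1 k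
  have hsmall := runEnd_small h1
  match k with
  | 0 =>
    rw [Function.iterate_zero, id, id] at hpos
    rw [Function.iterate_zero, id] at hi
    omega
  | 1 => omega
  | 2 => omega
  | k + 3 =>
    rw [runEnd_add_three h1] at hj
    exact ⟨k, s, h0, h1, rfl, hi, by omega⟩

/-! ### Cubes and their roots. -/

/-- The factor of `𝕋` of length `p` starting at index `i`. -/
def fac (i p : ℕ) : List Letter := (List.range p).map fun x => seq (i + x)

theorem fac_length (i p : ℕ) : (fac i p).length = p := by simp [fac]

theorem fac_add (i p q : ℕ) : fac i (p + q) = fac i p ++ fac (i + p) q := by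
  simp [fac, List.range_add, add_assoc]

theorem pref_eq_fac (n : ℕ) : pref n = fac 0 n := by simp [pref, fac]

theorem shiftEq_iff_fac (p i q : ℕ) : ShiftEq p i (i + q) ↔ fac i q = fac (i + p) q := by
  simp only [fac, List.map_inj_left, List.mem_range]
  constructor
  · intro h x hx
    rw [h (i + x) (by omega) (by omega)]
    congr 1
    omega
  · intro h x hx hx'
    have := h (x - i) (by omega)
    rwa [show i + (x - i) = x by omega, show i + p + (x - i) = x + p by omega] at this

theorem infix_pref_iff (w : List Letter) (n : ℕ) :
    w <:+: pref n ↔ ∃ i, i + w.length ≤ n ∧ w = fac i w.length := by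
  constructor
  · rintro ⟨s, u, h⟩
    have hn := congrArg List.length h
    simp only [List.length_append, pref_length] at hn
    rw [pref_eq_fac, ← hn, fac_add, fac_add] at h
    have h1 := (List.append_inj' h (by rw [fac_length])).1
    refine ⟨s.length, by omega, ?_⟩
    simpa using (List.append_inj h1 (by rw [fac_length])).2
  · rintro ⟨i, hi, h⟩
    obtain ⟨r, rfl⟩ := Nat.exists_eq_add_of_le hi
    refine ⟨fac 0 i, fac (i + w.length) r, ?_⟩
    rw [pref_eq_fac, fac_add, fac_add, zero_add, zero_add, ← h]

theorem cube_infix_iff (w : List Letter) (n : ℕ) :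
    (w ≠ [] ∧ w ++ w ++ w <:+: pref n) ↔
      ∃ i p, 1 ≤ p ∧ i + 3 * p ≤ n ∧ ShiftEq p i (i + 2 * p) ∧ w = fac i p := by
  rw [infix_pref_iff]
  constructor
  · rintro ⟨hw, i, hi, h⟩
    simp only [List.length_append] at hi h
    rw [fac_add, fac_add] at h
    obtain ⟨h1, h2⟩ := List.append_inj h (by simp [fac_length])
    obtain ⟨h3, h4⟩ := List.append_inj h1 (by simp [fac_length])
    refine ⟨i, w.length, List.length_pos_iff.2 hw, by omega, ?_, h3⟩
    rw [shiftEq_iff_fac, two_mul, fac_add, fac_add, ← h3, ← h4, add_assoc i, ← h2]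
  · rintro ⟨i, p, hp, hi, h, rfl⟩
    refine ⟨?_, i, ?_, ?_⟩
    · rw [← List.length_pos_iff, fac_length]
      exact hp
    · simp only [List.length_append, fac_length]
      omega
    · rw [shiftEq_iff_fac, two_mul, fac_add, fac_add] at h
      obtain ⟨h1, h2⟩ := List.append_inj h (by simp [fac_length])
      simp only [List.length_append, fac_length]
      rw [fac_add, fac_add, ← add_assoc i, ← h2, ← h1]

theorem six_le_of_seq_eq {s : ℕ} (h0 : seq s = .a) (h1 : seq (s + 1) = .a) : 6 ≤ s := by
  by_contra hc
  have key : ∀ s < 6, ¬ (seq s = .a ∧ seq (s + 1) = .a) := by decide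
  exact key s (by omega) ⟨h0, h1⟩

theorem seq_six : seq 6 = .a := by decide
theorem seq_seven : seq 7 = .a := by decide

theorem pos_iterate_six (k : ℕ) : pos^[k] 6 + trib k = trib (k + 3) := by
  rw [← pos_iterate_succ seq_six, ← pos_iterate_one (k + 3), Function.iterate_add_apply,
    show pos^[3] 1 = 7 from pos_iterate_one 3]

theorem pos_iterate_six_le {s : ℕ} (h0 : seq s = .a) (h1 : seq (s + 1) = .a) (k : ℕ) :
    pos^[k] 6 ≤ pos^[k] s :=
  (pos_iterate_strictMono k).monotone (six_le_of_seq_eq h0 h1)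

/-- Both factors lie inside the `k`-th image of `aa`, which is the same word at every occurrence. -/
theorem fac_pos_iterate_eq {s : ℕ} (h0 : seq s = .a) (h1 : seq (s + 1) = .a) (k : ℕ) {d : ℕ}
    (hd : d ≤ trib k) : fac (pos^[k] s + d) (trib k) = fac (pos^[k] 6 + d) (trib k) := by
  obtain ⟨r, rfl⟩ := Nat.exists_eq_add_of_le (six_le_of_seq_eq h0 h1)
  have h : ShiftEq r 6 (6 + 2) := by
    intro x hx hx'
    rcases (show x = 6 ∨ x = 7 by omega) with rfl | rfl
    · rw [h0, seq_six]
    · rw [show 7 + r = 6 + r + 1 by omega, h1, seq_seven]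
  obtain ⟨P, hP, hs⟩ := h.iterate k
  rw [pos_iterate_add_two seq_six seq_seven] at hs
  have h2 : ShiftEq P (pos^[k] 6 + d) (pos^[k] 6 + d + trib k) := hs.mono (by omega) (by omega)
  rw [shiftEq_iff_fac] at h2
  rw [hP, h2]
  congr 1
  omega

/-- The position at which the first occurrence of a cube of period `trib (k + 3)` ends. -/
def cubeEnd (k : ℕ) : ℕ := trib (k + 6) + 2 * trib (k + 3)

theorem cubeEnd_eq (k : ℕ) : cubeEnd k = pos^[k + 3] 6 + 3 * trib (k + 3) := by
  have := pos_iterate_six (k + 3)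
  simp only [cubeEnd, add_assoc, Nat.reduceAdd] at *
  omega

/-- The cube roots of period `trib (k + 3)`, indexed by `0, …, excess k`. -/
def cubeRoot (x : Σ _ : ℕ, ℕ) : List Letter := fac (pos^[x.1 + 3] 6 + x.2) (trib (x.1 + 3))

theorem cube_iff (w : List Letter) (n : ℕ) :
    (w ≠ [] ∧ w ++ w ++ w <:+: pref n) ↔
      ∃ k d, d ≤ excess k ∧ cubeEnd k + d ≤ n ∧ cubeRoot ⟨k, d⟩ = w := by
  rw [cube_infix_iff]
  constructor
  · rintro ⟨i, p, hp, hi, h, rfl⟩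
    obtain ⟨k, s, h0, h1, rfl, hs, hj⟩ := h.exists_cube_run hp le_rfl
    obtain ⟨d, rfl⟩ := Nat.exists_eq_add_of_le hs
    have h2 := pos_iterate_six_le h0 h1 (k + 3)
    have h3 := cubeEnd_eq k
    have h4 := three_mul_excess_le k
    have h5 := fac_pos_iterate_eq h0 h1 (k + 3) (d := d) (by omega)
    exact ⟨k, d, by omega, by omega, h5.symm⟩
  · rintro ⟨k, d, hd, hn, rfl⟩
    have h3 := cubeEnd_eq k
    have h4 := pos_iterate_add_two seq_six seq_seven (k + 3)
    refine ⟨pos^[k + 3] 6 + d, trib (k + 3), (trib_growth _).1, by omega, ?_, rfl⟩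
    have h := shiftEq_runEnd seq_six seq_seven (k + 3)
    rw [runEnd_add_three seq_seven] at h
    exact h.mono (by omega) (by omega)

/-- There are no fourth powers, because the excess of a run is at most a third of its period. -/
theorem not_shiftEq_three_mul {p i : ℕ} (hp : 1 ≤ p) : ¬ ShiftEq p i (i + 3 * p) := by
  intro h
  obtain ⟨k, s, h0, h1, rfl, hs, hj⟩ := h.exists_cube_run hp (by omega)
  have := three_mul_excess_le k
  omega

theorem cubeRoot_inj {k d k' d' : ℕ} (hd : d ≤ excess k) (hd' : d' ≤ excess k')
    (h : cubeRoot ⟨k, d⟩ = cubeRoot ⟨k', d'⟩) : k = k' ∧ d = d' := by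
  have hl := congrArg List.length h
  simp only [cubeRoot, fac_length] at hl
  have hk : k = k' := by
    have := trib_strictMono.injective hl
    omega
  subst hk
  refine ⟨rfl, ?_⟩
  wlog hlt : d < d' generalizing d d'
  · rcases Nat.lt_or_ge d' d with h1 | h1
    · exact (this hd' hd h.symm h1).symm
    · omega
  obtain ⟨r, rfl⟩ := Nat.exists_eq_add_of_le hlt.le
  simp only [cubeRoot] at h
  rw [← add_assoc, ← shiftEq_iff_fac] at h
  have h4 := three_mul_excess_le k
  -- Equal roots at offsets differing by `r ≤ excess k` give period `r` over a shift range of length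
  -- `trib (k + 3) ≥ 3 * r`, a fourth power.
  exact absurd (h.mono le_rfl (by omega)) (not_shiftEq_three_mul (by omega))

/-! ### Counting. -/

theorem B_eq_sum {n M : ℕ} (hM : ∀ k, M ≤ k → n < cubeEnd k) :
    B n = ∑ k ∈ Finset.range M, min (excess k + 1) (n + 1 - cubeEnd k) := by
  have h : {w : List Letter | w ≠ [] ∧ w ++ w ++ w <:+: pref n} = cubeRoot ''
      ((Finset.range M).sigma fun k => Finset.range (min (excess k + 1) (n + 1 - cubeEnd k)) :
        Finset (Σ _ : ℕ, ℕ)) := by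
    ext w
    rw [Set.mem_ofPred_eq, cube_iff]
    simp only [Set.mem_image, Finset.mem_coe, Finset.mem_sigma, Finset.mem_range, Sigma.exists]
    refine exists_congr fun k => exists_congr fun d => ?_
    rw [← and_assoc]
    refine and_congr_left fun _ => ?_
    have := hM k
    omega
  rw [B, h, Set.InjOn.ncard_image, Set.ncard_coe_finset, Finset.card_sigma]
  · simp
  · rintro ⟨k, d⟩ hx ⟨k', d'⟩ hy he
    simp only [Finset.mem_coe, Finset.mem_sigma, Finset.mem_range] at hx hy
    obtain ⟨rfl, rfl⟩ := cubeRoot_inj (by omega) (by omega) he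
    rfl

theorem cubeEnd_strictMono : StrictMono cubeEnd := by
  refine strictMono_nat_of_lt_succ fun k => ?_
  have h1 := trib_strictMono (show k + 6 < k + 1 + 6 by omega)
  have h2 := trib_strictMono (show k + 3 < k + 1 + 3 by omega)
  simp only [cubeEnd]
  omega

theorem cubeEnd_add_excess_lt (k : ℕ) : cubeEnd k + excess k < cubeEnd (k + 1) := by
  have h1 := trib_add_three (k + 4)
  have h2 := trib_strictMono (show k + 3 < k + 4 by omega)
  have h3 := three_mul_excess_le k
  simp only [cubeEnd, add_assoc, Nat.reduceAdd] at *
  omega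

theorem two_mul_sum_excess (K : ℕ) :
    2 * ∑ k ∈ Finset.range K, (excess k + 1) + trib (K + 2) + K + 3 = trib (K + 3) := by
  induction K with
  | zero => rfl
  | succ K ih =>
    have h1 := two_mul_excess K
    have h2 := trib_add_three (K + 1)
    have h3 := trib_add_three (K + 2)
    rw [Finset.sum_range_succ]
    simp only [add_assoc, Nat.reduceAdd, add_comm 1] at *
    omega

theorem B_eq_of_mem_Ico {n K : ℕ} (h1 : cubeEnd K ≤ n) (h2 : n < cubeEnd (K + 1)) :
    B n = ∑ k ∈ Finset.range K, (excess k + 1) + min (excess K + 1) (n + 1 - cubeEnd K) := by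
  rw [B_eq_sum (M := K + 1) fun k hk => h2.trans_le (cubeEnd_strictMono.monotone hk),
    Finset.sum_range_succ]
  congr 1
  -- All smaller periods are saturated: their last new cube ends before `cubeEnd K`.
  refine Finset.sum_congr rfl fun k hk => ?_
  have h3 := cubeEnd_add_excess_lt k
  have h4 := cubeEnd_strictMono.monotone (Nat.succ_le_of_lt (Finset.mem_range.1 hk))
  simp only [Nat.succ_eq_add_one] at h4
  omega

theorem B_eq_zero {n : ℕ} (h : n ≤ 57) : B n = 0 := by
  have h58 : cubeEnd 0 = 58 := by decide
  rw [B_eq_sum (M := 0) fun k _ => by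
    have := cubeEnd_strictMono.monotone (Nat.zero_le k)
    omega]
  rfl

/-! ### Translation to the integer-indexed statement, with `m = k + 7`. -/

theorem t_natCast (k : ℕ) : t (k : ℤ) = trib k := rfl

theorem t_add_sub (k a b : ℕ) (h : b ≤ a) : t ((k : ℤ) + a - b) = trib (k + (a - b)) := by
  rw [← t_natCast]
  congr 1
  omega

/-- The left end of the interval of prefix lengths associated with `m = j + 2`. -/
def bound (j : ℕ) : ℕ := t ((j : ℤ) + 1) + 2 * t ((j : ℤ) - 2)

theorem bound_add_two (j : ℕ) : bound (j + 2) = trib (j + 3) + 2 * trib j := by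
  rw [bound, ← t_natCast, ← t_natCast]
  congr 3
  push_cast
  ring

theorem bound_add_five (k : ℕ) : bound (k + 5) = cubeEnd k := bound_add_two (k + 3)

theorem bound_strictMono : StrictMono bound := by
  refine strictMono_nat_of_lt_succ fun j => ?_
  match j with
  | 0 => decide
  | 1 => decide
  | j + 2 =>
    have h1 := trib_strictMono (show j + 3 < j + 1 + 3 by omega)
    have h2 := trib_strictMono (show j < j + 1 by omega)
    have h3 := bound_add_two j
    have h4 : bound (j + 2 + 1) = _ := bound_add_two (j + 1)
    omega

theorem cubeEnd_zero : cubeEnd 0 = 58 := by decide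

theorem exists_cubeEnd_le_lt {n : ℕ} (hn : 58 ≤ n) :
    ∃ k, cubeEnd k ≤ n ∧ n < cubeEnd (k + 1) := by
  have h : ∃ k, n < cubeEnd (k + 1) := ⟨n, cubeEnd_strictMono.le_apply⟩
  refine ⟨Nat.find h, ?_, Nat.find_spec h⟩
  rcases Nat.eq_zero_or_pos (Nat.find h) with h0 | h0
  · rw [h0, cubeEnd_zero]
    exact hn
  · have := Nat.find_min h (m := Nat.find h - 1) (by omega)
    rwa [Nat.sub_add_cancel h0, not_lt] at this

theorem bounds_iff {n : ℕ} {m : ℤ} (hn : 58 ≤ n) :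
    (2 ≤ m ∧ t (m - 1) + 2 * t (m - 4) ≤ n ∧ n < t m + 2 * t (m - 3)) ↔
      ∃ k : ℕ, m = k + 7 ∧ cubeEnd k ≤ n ∧ n < cubeEnd (k + 1) := by
  have key (j : ℕ) : bound j = t ((j : ℤ) + 2 - 1) + 2 * t ((j : ℤ) + 2 - 4) ∧
      bound (j + 1) = t ((j : ℤ) + 2) + 2 * t ((j : ℤ) + 2 - 3) := by
    rw [bound, bound, show (j : ℤ) + 2 - 1 = j + 1 by ring, show (j : ℤ) + 2 - 4 = j - 2 by ring,
      show ((j + 1 : ℕ) : ℤ) + 1 = j + 2 by push_cast; ring,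
      show ((j + 1 : ℕ) : ℤ) - 2 = j + 2 - 3 by push_cast; ring]
    exact ⟨rfl, rfl⟩
  constructor
  · rintro ⟨hm, h1, h2⟩
    obtain ⟨j, rfl⟩ : ∃ j : ℕ, m = j + 2 := ⟨(m - 2).toNat, by omega⟩
    rw [← (key j).1] at h1
    rw [← (key j).2] at h2
    have h5 : 5 ≤ j := by
      by_contra hc
      have := bound_strictMono.monotone (show j + 1 ≤ 5 by omega)
      have h58 : bound 5 = 58 := (bound_add_five 0).trans cubeEnd_zero
      omega
    obtain ⟨k, rfl⟩ := Nat.exists_eq_add_of_le' h5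
    rw [bound_add_five] at h1
    rw [show k + 5 + 1 = k + 1 + 5 by omega, bound_add_five] at h2
    exact ⟨k, by push_cast; ring, h1, h2⟩
  · rintro ⟨k, rfl, h1, h2⟩
    rw [← bound_add_five] at h1 h2
    rw [show (k : ℤ) + 7 = ((k + 5 : ℕ) : ℤ) + 2 by push_cast; ring, ← (key _).1, ← (key _).2]
    exact ⟨by omega, h1, by rwa [show k + 5 + 1 = k + 1 + 5 by omega]⟩

theorem cubeEnd_index_unique {n k k' : ℕ} (h1 : cubeEnd k ≤ n) (h2 : n < cubeEnd (k + 1))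
    (h1' : cubeEnd k' ≤ n) (h2' : n < cubeEnd (k' + 1)) : k = k' := by
  have h3 := cubeEnd_strictMono.lt_iff_lt.1 (h1.trans_lt h2')
  have h4 := cubeEnd_strictMono.lt_iff_lt.1 (h1'.trans_lt h2)
  omega

/-- By `two_mul_excess`, the threshold `h` says exactly `n ≤ cubeEnd k + excess k`: the growth phase
of period `trib (k + 3)`. -/
theorem two_mul_B_of_le {n k : ℕ} (h1 : cubeEnd k ≤ n) (h2 : n < cubeEnd (k + 1))
    (h : 2 * n + trib (k + 4) + 3 ≤ 3 * trib (k + 6)) :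
    2 * B n + 4 * trib (k + 6) + k + 1 = 2 * n + trib (k + 5) + 3 * trib (k + 4) := by
  have e0 := B_eq_of_mem_Ico h1 h2
  have e1 := two_mul_sum_excess k
  have e2 := two_mul_excess k
  have e3 := trib_add_three (k + 3)
  have e4 := trib_add_three (k + 2)
  simp only [cubeEnd, add_assoc, Nat.reduceAdd] at *
  omega

theorem two_mul_B_of_lt {n k : ℕ} (h1 : cubeEnd k ≤ n) (h2 : n < cubeEnd (k + 1))
    (h : 3 * trib (k + 6) < 2 * n + trib (k + 4) + 3) :
    2 * B n + k + 4 = trib (k + 2) + trib (k + 1) := by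
  have e0 := B_eq_of_mem_Ico h1 h2
  have e1 := two_mul_sum_excess k
  have e2 := two_mul_excess k
  have e3 := trib_add_three (k + 3)
  have e4 := trib_add_three (k + 2)
  have e5 := trib_add_three (k + 1)
  simp only [cubeEnd, add_assoc, Nat.reduceAdd] at *
  omega

end Tribonacci

theorem mainTheorem3 :
    (∀ n : ℕ, n ≤ 57 → Tribonacci.B n = 0) ∧
    (∀ n : ℕ, 58 ≤ n →
      (∃! m : ℤ, 2 ≤ m ∧
        Tribonacci.t (m - 1) + 2 * Tribonacci.t (m - 4) ≤ n ∧
        n < Tribonacci.t m + 2 * Tribonacci.t (m - 3)) ∧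
      (∀ m : ℤ, 2 ≤ m →
        Tribonacci.t (m - 1) + 2 * Tribonacci.t (m - 4) ≤ n →
        n < Tribonacci.t m + 2 * Tribonacci.t (m - 3) →
        7 ≤ m ∧
        ((n : ℚ) ≤ (3 * (Tribonacci.t (m - 1) : ℚ) - Tribonacci.t (m - 3) - 3) / 2 →
          (Tribonacci.B n : ℚ) =
            n - (4 * (Tribonacci.t (m - 1) : ℚ) - Tribonacci.t (m - 2)
              - 3 * Tribonacci.t (m - 3) + m - 6) / 2) ∧
        (¬ (n : ℚ) ≤ (3 * (Tribonacci.t (m - 1) : ℚ) - Tribonacci.t (m - 3) - 3) / 2 →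
          (Tribonacci.B n : ℚ) =
            ((Tribonacci.t (m - 5) : ℚ) + Tribonacci.t (m - 6) - m + 3) / 2))) := by
  open Tribonacci in
  refine ⟨fun n => B_eq_zero, fun n hn => ⟨?_, ?_⟩⟩
  · obtain ⟨k, h1, h2⟩ := exists_cubeEnd_le_lt hn
    refine ⟨k + 7, (bounds_iff hn).2 ⟨k, rfl, h1, h2⟩, fun m hm => ?_⟩
    obtain ⟨k', rfl, h1', h2'⟩ := (bounds_iff hn).1 hm
    rw [cubeEnd_index_unique h1 h2 h1' h2']
  · intro m hm hl hu
    obtain ⟨k, rfl, h1, h2⟩ := (bounds_iff hn).1 ⟨hm, hl, hu⟩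
    have e1 : t ((k : ℤ) + 7 - 1) = trib (k + 6) := t_add_sub k 7 1 (by omega)
    have e2 : t ((k : ℤ) + 7 - 2) = trib (k + 5) := t_add_sub k 7 2 (by omega)
    have e3 : t ((k : ℤ) + 7 - 3) = trib (k + 4) := t_add_sub k 7 3 (by omega)
    have e5 : t ((k : ℤ) + 7 - 5) = trib (k + 2) := t_add_sub k 7 5 (by omega)
    have e6 : t ((k : ℤ) + 7 - 6) = trib (k + 1) := t_add_sub k 7 6 (by omega)
    rw [e1, e2, e3, e5, e6]
    have hcond : (n : ℚ) ≤ (3 * (trib (k + 6) : ℚ) - trib (k + 4) - 3) / 2 ↔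
        2 * n + trib (k + 4) + 3 ≤ 3 * trib (k + 6) := by
      rw [← Nat.cast_le (α := ℚ)]
      push_cast
      constructor <;> intro h <;> linarith
    rw [hcond]
    push_cast
    refine ⟨by omega, fun h => ?_, fun h => ?_⟩
    · have := congrArg (Nat.cast (R := ℚ)) (two_mul_B_of_le h1 h2 h)
      push_cast at this
      linarith
    · have := congrArg (Nat.cast (R := ℚ)) (two_mul_B_of_lt h1 h2 (not_le.1 h))
      push_cast at this
      linarith
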